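/- **Setting.** Let $n$ agents $1,\dots,n$ run in synchronous rounds, round $m+1$ lying between times $m$ and $m+1$; agent $i$ starts with an initial value $v_i\in\{0,1\}$. Let $t\le n$. In the failure model $\mathit{Crash}_t$ at most $t$ agents crash in a run; an agent acts correctly until the round in which it crashes, in that round an arbitrary subset of its messages is delivered, and afterwards it sends nothing. From the end of the round of its crash on, its local state is $\mathit{crashed}$. Let $\mathcal N(r,m)$ be the set of agents whose local state at time $m$ of run $r$ is not $\mathit{crashed}$ (the nonfailed agents). In the *FloodSet information exchange* a nonfailed agent $i$ has at time $m$ a local state $\langle W_i,m,v_i\rangle$, with $W_i=\{v_i\}$ at time $0$. In each round it sends $W_i$ to all agents, and replaces $W_i$ by the union of $W_i$ and all sets received. Messages and states do not depend on the agents' decisions, so the set of runs $r$ does not depend on the decision protocol. Let $\mathcal I$ be the system of all these runs, for all initial values and all adversaries in $\mathit{Crash}_t$. At a point $(r,m)$ of $\mathcal I$, $\exists v$ says that some agent has initial value $v$ in $r$; $K_i\varphi$ says that $\varphi$ holds at all points $(r',m')$ of $\mathcal I$ at which $i$ has the same local state as at $(r,m)$; $E_{\mathcal N}\varphi$ says that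 $K_i\varphi$ holds for all $i\in\mathcal N(r,m)$; and $C_{\mathcal N}\varphi$ says that $E_{\mathcal N}^k\varphi$ holds for all $k\ge 1$. A *decision protocol* $P$ assigns to each local state of agent $i$ an action, $\mathtt{decide}_i(v)$ with $v\in\{0,1\}$ or $\mathtt{noop}$. It is an *SBA protocol* if in every run: any two decisions made by nonfailed agents, at the same or at different times, are on the same value (agreement); a value decided by a nonfailed agent is the initial value of some agent (validity); and if a nonfailed agent decides at a time, then every agent nonfailed at that time decides at that time (simultaneity). An SBA protocol $P$ is *optimum* for the exchange if for every SBA protocol $P'$ for the same exchange, all runs $r'$ of $P'$ and $r$ of $P$ with the same initial values and the same adversary, and every time $m$, each nonfailed agent that decides at time $m$ of $r'$ also decides (possibly on another value) at time $m$ of $r$. Let $P^{\mathrm{flood}+}$ be the decision protocol in which a nonfailed agent $i$ with state $\langle W_i,m,v_i\rangle$ does $\mathtt{decide}_i(\min W_i)$ if $m\ge\min\{t+1,n-1\}$, and $\mathtt{noop}$ otherwise. **Theorem.** (1) For every point $(r,m)$ of $\mathcal I$ and every $i\in\mathcal N(r,m)$, $$(\mathcal I,r,m)\models\bigvee_{v\in\{0,1\}}K_i\bigl(C_{\mathcal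 N}(\exists v)\bigr)\quad\text{if and only if}\quad m\ge\min\{t+1,n-1\}.$$ If $t<n$, it is also true at every point $(r,m)$ of $\mathcal I$ that $(\mathcal I,r,m)\models\bigvee_{v}K_i(C_{\mathcal N}(\exists v))$ holds for all $i\in\mathcal N(r,m)$ if and only if $m\ge\min\{t+1,n-1\}$. (2) $P^{\mathrm{flood}+}$ is an optimum SBA protocol for the FloodSet information exchange in $\mathit{Crash}_t$, and it terminates: in every run every agent eventually decides or fails. -/

import Mathlib

namespace SBA

/-- The set of initial values `{0, 1}`. -/
abbrev Value := Fin 2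

/-- The actions of an agent. -/
inductive Action where
  | decideVal (v : Value)
  | noop

/-- Adversaries. `F m i j = true` means that the message that agent `i` is supposed to send to
agent `j` in round `m + 1` (the round between time `m` and time `m + 1`) is delivered, and
`F m i i = false` means that agent `i` has crashed in round `m + 1` or earlier. -/
abbrev Adversary (n : ℕ) := ℕ → Fin n → Fin n → Bool

/-- The hard crash failure model with at most `t` faulty agents: an agent omits a message only in
the round in which it crashes or later, in the round of the crash an arbitrary subset of its
messages is delivered, and after that round none is. -/
def Crash (n t : ℕ) : Set (Adversary n) :=
  {F | (∀ m i j, F m i j = false → F m i i = false) ∧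
    (∀ m i, F m i i = false → ∀ m', m < m' → ∀ k, F m' i k = false) ∧
    {i : Fin n | ∃ m j, F m i j = false}.ncard ≤ t}

/-- Information exchange protocols for `n` agents in the crash failure model. The initial states
of agent `i` are the states `initState i v`, one for each initial value `v`. -/
structure InfoExchange (n : ℕ) where
  /-- local states -/
  Loc : Fin n → Type
  /-- the special local state of an agent that has crashed -/
  crashed : ∀ i, Loc i
  /-- the initial local state with a given initial value -/
  initState : ∀ i, Value → Loc i
  initState_injective : ∀ i, Function.Injective (initState i)
  /-- messages; the absence of a message is `none` in `Option (Msg i)` -/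
  Msg : Fin n → Type
  /-- message selection -/
  select : ∀ i, Loc i → Action → Fin n → Option (Msg i)
  /-- state update; the last argument is the vector of received messages -/
  update : ∀ i, Loc i → Adversary n → Action → (∀ j, Option (Msg j)) → Loc i

variable {n : ℕ}

/-- Decision protocols for an information exchange. -/
abbrev DecisionProtocol (E : InfoExchange n) := ∀ i, E.Loc i → Action

/-- Global states: the state of the environment (an adversary) and a local state of each agent. -/
structure GlobalState (E : InfoExchange n) where
  env : Adversary n
  loc : ∀ i, E.Loc i

/-- Mappings from times to global states. -/
abbrev Run (E : InfoExchange n) := ℕ → GlobalState E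

/-- The global state at time `k + 1` if the one at time `k` is `g`. -/
def step {E : InfoExchange n} (P : DecisionProtocol E) (k : ℕ) (g : GlobalState E) :
    GlobalState E where
  env := g.env
  loc := fun i => E.update i (g.loc i) g.env (P i (g.loc i))
    (fun j => if g.env k j i then E.select j (g.loc j) (P j (g.loc j)) i else none)

/-- The runs of the protocol `(P, E)` in the failure model `Crash n t`. -/
def Runs (E : InfoExchange n) (P : DecisionProtocol E) (t : ℕ) : Set (Run E) :=
  {r | (r 0).env ∈ Crash n t ∧ (∀ i, ∃ v, (r 0).loc i = E.initState i v) ∧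
    ∀ k, r (k + 1) = step P k (r k)}

/-- `HasInit r i v`: agent `i` has initial value `v` in the run `r`. -/
def HasInit {E : InfoExchange n} (r : Run E) (i : Fin n) (v : Value) : Prop :=
  (r 0).loc i = E.initState i v

/-- The indexical set of nonfailed agents. -/
def Nonfailed {E : InfoExchange n} (r : Run E) (m : ℕ) : Set (Fin n) :=
  {i | (r m).loc i ≠ E.crashed i}

/-- Atomic propositions: "some agent has initial value `v`" and "agent `i` has not failed". -/
inductive Atom (n : ℕ) where
  | existsVal (v : Value)
  | nonfailed (i : Fin n)

/-- Interpreted systems: a set of runs with an interpretation of the atomic propositions. -/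
structure InterpretedSystem (E : InfoExchange n) where
  runs : Set (Run E)
  interp : Run E → ℕ → Atom n → Prop

/-- The interpreted system generated by `(P, E)` in the failure model `Crash n t`. -/
def system (E : InfoExchange n) (P : DecisionProtocol E) (t : ℕ) : InterpretedSystem E where
  runs := Runs E P t
  interp := fun r m a => match a with
    | Atom.existsVal v => ∃ i, HasInit r i v
    | Atom.nonfailed i => i ∈ Nonfailed r m

/-- Formulas of the logic of knowledge and common knowledge among the nonfailed agents. -/
inductive Formula (n : ℕ) where
  | atom (a : Atom n)
  | neg (φ : Formula n)
  | and (φ ψ : Formula n)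
  | or (φ ψ : Formula n)
  | know (i : Fin n) (φ : Formula n)
  | everyone (φ : Formula n)
  | common (φ : Formula n)

/-- The semantic operator `K i` on properties of points. -/
def Knows {E : InfoExchange n} (I : InterpretedSystem E) (i : Fin n) (A : Run E → ℕ → Prop)
    (r : Run E) (m : ℕ) : Prop :=
  ∀ r' ∈ I.runs, ∀ m', (r m).loc i = (r' m').loc i → A r' m'

/-- The semantic operator "every nonfailed agent knows" on properties of points. -/
def EveryoneKnows {E : InfoExchange n} (I : InterpretedSystem E) (A : Run E → ℕ → Prop)
    (r : Run E) (m : ℕ) : Prop :=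
  ∀ i ∈ Nonfailed r m, Knows I i A r m

/-- `Sat I φ r m`: the formula `φ` is true at the point `(r, m)` of `I`. -/
def Sat {E : InfoExchange n} (I : InterpretedSystem E) : Formula n → Run E → ℕ → Prop
  | Formula.atom a => fun r m => I.interp r m a
  | Formula.neg φ => fun r m => ¬ Sat I φ r m
  | Formula.and φ ψ => fun r m => Sat I φ r m ∧ Sat I ψ r m
  | Formula.or φ ψ => fun r m => Sat I φ r m ∨ Sat I ψ r m
  | Formula.know i φ => Knows I i (Sat I φ)
  | Formula.everyone φ => EveryoneKnows I (Sat I φ)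
  | Formula.common φ => fun r m => ∀ k : ℕ, 1 ≤ k → (EveryoneKnows I)^[k] (Sat I φ) r m

/-- `Decides P r m i v`: agent `i` has not failed at time `m` of `r`, and `P` lets it decide `v`
in round `m + 1`. -/
def Decides {E : InfoExchange n} (P : DecisionProtocol E) (r : Run E) (m : ℕ) (i : Fin n)
    (v : Value) : Prop :=
  i ∈ Nonfailed r m ∧ P i ((r m).loc i) = Action.decideVal v

/-- SBA protocols: agreement (also between different times), validity and simultaneity. -/
structure IsSBA (E : InfoExchange n) (t : ℕ) (P : DecisionProtocol E) : Prop where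
  agreement : ∀ r ∈ Runs E P t, ∀ m m' i j v v',
    Decides P r m i v → Decides P r m' j v' → v = v'
  validity : ∀ r ∈ Runs E P t, ∀ m i v, Decides P r m i v → ∃ j, HasInit r j v
  simultaneity : ∀ r ∈ Runs E P t, ∀ m i v, Decides P r m i v →
    ∀ j ∈ Nonfailed r m, ∃ w, Decides P r m j w

/-- Termination: every agent eventually decides or fails. -/
def Terminates (E : InfoExchange n) (t : ℕ) (P : DecisionProtocol E) : Prop :=
  ∀ r ∈ Runs E P t, ∀ i, ∃ m, i ∉ Nonfailed r m ∨ ∃ v, Decides P r m i v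

/-- Corresponding runs: the same initial values and the same adversary. -/
def Correspond {E E' : InfoExchange n} (r : Run E) (r' : Run E') : Prop :=
  (∀ i v, HasInit r i v ↔ HasInit r' i v) ∧ (r 0).env = (r' 0).env

/-- `P ≤ P'`: whenever a nonfailed agent decides with `P`, it also decides, possibly on another
value, with `P'` at the same time of the corresponding run. -/
def ProtocolLE (E : InfoExchange n) (t : ℕ) (P P' : DecisionProtocol E) : Prop :=
  ∀ r ∈ Runs E P t, ∀ r' ∈ Runs E P' t, Correspond r r' →
    ∀ m i v, Decides P r m i v → ∃ w, Decides P' r' m i w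

/-- Optimum SBA protocols with respect to an information exchange. -/
def IsOptimumSBA (E : InfoExchange n) (t : ℕ) (P : DecisionProtocol E) : Prop :=
  IsSBA E t P ∧ ∀ P' : DecisionProtocol E, IsSBA E t P' → ProtocolLE E t P' P

/-- Local states of the FloodSet information exchange: the state of a crashed agent, or the set
`W` of values seen so far with the current time `m` and the initial value `v` of the agent. -/
inductive FloodState where
  | crashed
  | live (W : Finset Value) (m : ℕ) (v : Value)

/-- The FloodSet information exchange. -/
def flood (n : ℕ) : InfoExchange n where
  Loc := fun _ => FloodState
  crashed := fun _ => FloodState.crashed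
  initState := fun _ v => FloodState.live {v} 0 v
  initState_injective := fun _ v w h => by
    injection h
  Msg := fun _ => Finset Value
  select := fun _ s _ _ => match s with
    | FloodState.crashed => none
    | FloodState.live W _ _ => some W
  update := fun i s F _ msg => match s with
    | FloodState.crashed => FloodState.crashed
    | FloodState.live W m v =>
      if F m i i then
        FloodState.live (W ∪ Finset.univ.biUnion fun j => (msg j).getD ∅) (m + 1) v
      else FloodState.crashed

/-- The modified FloodSet decision protocol: decide the least value seen so far as soon as the
time is at least `min (t + 1) (n - 1)`. (The set `W` is nonempty in every state that occurs.) -/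
def floodPlus (n t : ℕ) : DecisionProtocol (flood n) := fun _ s => match s with
  | FloodState.crashed => Action.noop
  | FloodState.live W m _ =>
    if min (t + 1) (n - 1) ≤ m then
      if h : W.Nonempty then Action.decideVal (W.min' h) else Action.noop
    else Action.noop

/-- The formula `⋁ v, K i (C (∃ v))`, where `v` ranges over the values `0` and `1`. -/
def knowsCommonValue (i : Fin n) : Formula n :=
  Formula.or
    (Formula.know i (Formula.common (Formula.atom (Atom.existsVal 0))))
    (Formula.know i (Formula.common (Formula.atom (Atom.existsVal 1))))

end SBA

namespace SBA

/-! Everything rests on what happens on either side of the bound `min (t + 1) (n - 1)`.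

At or after the bound, all nonfailed agents have seen the same values (`seenUniform_of_le`): either
some round had no crash, or every round had one and at most one agent is left. An agent that has
seen `x` then knows that all nonfailed agents have seen `x`, and this fact reproduces itself under
`EveryoneKnows`, so `∃ x` is common knowledge. As the sets are also frozen from then on, `floodPlus`
agrees with itself across times.

Before the bound, chains of points indistinguishable to some nonfailed agent lead from any run with
a nonfailed agent to both failure-free runs with constant initial values
(`failureFree_const_of_closed`). Common knowledge of `∃ x` is preserved along such chains, and so is
"all nonfailed agents decide `x`" for an SBA protocol. Either would reach the run where everyone
starts with `1 - x`, where the first is false and the second violates validity. This gives both the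
epistemic lower bound and optimality. -/

variable {n t : ℕ}

/-! ### Runs and local states of the FloodSet exchange -/

/-- The local states in the run of the FloodSet exchange with adversary `F` and initial
values `v`. -/
def floodLoc (F : Adversary n) (v : Fin n → Value) : ℕ → ∀ i, (flood n).Loc i
  | 0 => fun i => (flood n).initState i (v i)
  | m + 1 => fun i => (flood n).update i (floodLoc F v m i) F Action.noop
      (fun j => if F m j i then (flood n).select j (floodLoc F v m j) Action.noop i else none)

/-- The run of the FloodSet exchange with adversary `F` and initial values `v`. -/
def floodRun (F : Adversary n) (v : Fin n → Value) : Run (flood n) :=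
  fun m => ⟨F, floodLoc F v m⟩

/-- Definitional for every `P`, since neither `select` nor `update` of `flood` looks at the action;
the `noop` in `floodLoc` is a placeholder. -/
theorem floodRun_succ (P : DecisionProtocol (flood n)) (F : Adversary n) (v : Fin n → Value)
    (m : ℕ) : floodRun F v (m + 1) = step P m (floodRun F v m) := rfl

theorem mem_runs_flood_iff {P : DecisionProtocol (flood n)} {r : Run (flood n)} :
    r ∈ Runs (flood n) P t ↔ ∃ F ∈ Crash n t, ∃ v, r = floodRun F v := by
  constructor
  · rintro ⟨hF, hv, hs⟩
    choose v hv using hv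
    refine ⟨(r 0).env, hF, v, funext fun m => ?_⟩
    induction m with
    | zero =>
      have h : (r 0).loc = floodLoc (r 0).env v 0 := funext hv
      change r 0 = ⟨(r 0).env, floodLoc (r 0).env v 0⟩
      rw [← h]
    | succ m ih => rw [hs, floodRun_succ P, ← ih]
  · rintro ⟨F, hF, v, rfl⟩
    exact ⟨hF, fun i => ⟨v i, rfl⟩, fun k => floodRun_succ P F v k⟩

theorem hasInit_floodRun {F : Adversary n} {v : Fin n → Value} {i : Fin n} {w : Value} :
    HasInit (floodRun F v) i w ↔ v i = w :=
  (flood n).initState_injective i |>.eq_iff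

/-- Agent `i` does not crash in the first `m` rounds. -/
def Alive (F : Adversary n) (m : ℕ) (i : Fin n) : Prop := ∀ k < m, F k i i = true

theorem Alive.mono {F : Adversary n} {k m : ℕ} {i : Fin n} (h : Alive F m i) (hk : k ≤ m) :
    Alive F k i := fun l hl => h l (hl.trans_le hk)

theorem alive_succ {F : Adversary n} {m : ℕ} {i : Fin n} :
    Alive F (m + 1) i ↔ Alive F m i ∧ F m i i = true := by
  simp only [Alive, Nat.lt_succ_iff_lt_or_eq]
  exact ⟨fun h => ⟨fun k hk => h k (.inl hk), h m (.inr rfl)⟩,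
    fun h k hk => hk.elim (h.1 k) fun e => e ▸ h.2⟩

theorem alive_of_delivered {F : Adversary n} (hF : F ∈ Crash n t) {m : ℕ} {i j : Fin n}
    (h : F m i j = true) : Alive F m i := by
  intro k hk
  by_contra hc
  have := hF.2.1 k i (by simpa using hc) m hk j
  simp [this] at h

theorem delivered_of_alive {F : Adversary n} (hF : F ∈ Crash n t) {m : ℕ} {i : Fin n}
    (h : F m i i = true) (j : Fin n) : F m i j = true := by
  by_contra hc
  have := hF.1 m i j (by simpa using hc)
  simp [this] at h

/-- The set of values agent `i` has seen at time `m`. -/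
def seen (F : Adversary n) (v : Fin n → Value) : ℕ → Fin n → Finset Value
  | 0 => fun i => {v i}
  | m + 1 => fun i =>
      seen F v m i ∪ Finset.univ.biUnion fun j => if F m j i then seen F v m j else ∅

theorem mem_seen_succ {F : Adversary n} {v : Fin n → Value} {m : ℕ} {i : Fin n} {w : Value} :
    w ∈ seen F v (m + 1) i ↔ w ∈ seen F v m i ∨ ∃ j, F m j i = true ∧ w ∈ seen F v m j := by
  simp only [seen, Finset.mem_union, Finset.mem_biUnion, Finset.mem_univ, true_and]
  refine or_congr Iff.rfl (exists_congr fun j => ?_)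
  split_ifs with h <;> simp [h]

theorem floodLoc_of_alive_of_not {F : Adversary n} (hF : F ∈ Crash n t) (v : Fin n → Value)
    (m : ℕ) (i : Fin n) :
    (Alive F m i → floodLoc F v m i = FloodState.live (seen F v m i) m (v i)) ∧
    (¬ Alive F m i → floodLoc F v m i = FloodState.crashed) := by
  induction m generalizing i with
  | zero => exact ⟨fun _ => rfl, fun h => absurd (fun k hk => absurd hk (Nat.not_lt_zero k)) h⟩
  | succ m ih =>
    constructor
    · intro h
      obtain ⟨h, hi⟩ := alive_succ.1 h
      simp only [floodLoc, (ih i).1 h, flood, hi, if_true, seen]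
      congr 2
      refine Finset.biUnion_congr rfl fun j _ => ?_
      -- A delivered message comes from a live sender and carries its seen set; an undelivered one
      -- is `none`, which `getD` turns into `∅`.
      by_cases hj : F m j i = true
      · rw [if_pos hj, if_pos hj, (ih j).1 (alive_of_delivered hF hj)]
        rfl
      · rw [if_neg hj, if_neg hj]
        rfl
    · intro h
      by_cases ha : Alive F m i
      · have hi : ¬ F m i i = true := fun hi => h (alive_succ.2 ⟨ha, hi⟩)
        simp only [floodLoc, (ih i).1 ha, flood, hi]
        rfl
      · simp only [floodLoc, (ih i).2 ha, flood]

theorem floodLoc_of_alive {F : Adversary n} (hF : F ∈ Crash n t) (v : Fin n → Value)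
    {m : ℕ} {i : Fin n} (h : Alive F m i) :
    floodLoc F v m i = FloodState.live (seen F v m i) m (v i) :=
  (floodLoc_of_alive_of_not hF v m i).1 h

theorem mem_nonfailed_floodRun {F : Adversary n} (hF : F ∈ Crash n t) {v : Fin n → Value}
    {m : ℕ} {i : Fin n} : i ∈ Nonfailed (floodRun F v) m ↔ Alive F m i := by
  constructor
  · intro h
    by_contra hc
    exact h ((floodLoc_of_alive_of_not hF v m i).2 hc)
  · intro h hc
    have := (floodLoc_of_alive hF v h).symm.trans hc
    cases this

theorem init_mem_seen (F : Adversary n) (v : Fin n → Value) (m : ℕ) (i : Fin n) :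
    v i ∈ seen F v m i := by
  induction m with
  | zero => simp [seen]
  | succ m ih => exact mem_seen_succ.2 (.inl ih)

theorem exists_init_of_mem_seen {F : Adversary n} {v : Fin n → Value} {m : ℕ} {i : Fin n}
    {w : Value} (h : w ∈ seen F v m i) : ∃ j, v j = w := by
  induction m generalizing i with
  | zero => exact ⟨i, by simpa [seen, eq_comm] using h⟩
  | succ m ih =>
    rcases mem_seen_succ.1 h with h | ⟨j, -, h⟩
    exacts [ih h, ih h]

theorem seen_const (F : Adversary n) (x : Value) (m : ℕ) (i : Fin n) :
    seen F (fun _ => x) m i = {x} := by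
  refine Finset.eq_singleton_iff_unique_mem.2 ⟨init_mem_seen F _ m i, fun w hw => ?_⟩
  obtain ⟨_, h⟩ := exists_init_of_mem_seen hw
  exact h.symm

/-! ### Uniformity of the seen sets from the bound on -/

/-- All agents alive at time `m` have seen the same values. -/
def SeenUniform (F : Adversary n) (v : Fin n → Value) (m : ℕ) : Prop :=
  ∀ i j, Alive F m i → Alive F m j → seen F v m i = seen F v m j

theorem SeenUniform.seen_succ {F : Adversary n} (hF : F ∈ Crash n t) {v : Fin n → Value} {m : ℕ}
    (h : SeenUniform F v m) {i : Fin n} (hi : Alive F m i) :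
    seen F v (m + 1) i = seen F v m i := by
  ext w
  rw [mem_seen_succ]
  refine ⟨?_, .inl⟩
  rintro (hw | ⟨j, hj, hw⟩)
  · exact hw
  · rwa [h i j hi (alive_of_delivered hF hj)]

theorem SeenUniform.seen_eq {F : Adversary n} (hF : F ∈ Crash n t) {v : Fin n → Value} {m : ℕ}
    (h : SeenUniform F v m) {m' : ℕ} (hm : m ≤ m') :
    SeenUniform F v m' ∧ ∀ i, Alive F m' i → seen F v m' i = seen F v m i := by
  induction m', hm using Nat.le_induction with
  | base => exact ⟨h, fun _ _ => rfl⟩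
  | succ k hk ih =>
    have key : ∀ i, Alive F (k + 1) i → seen F v (k + 1) i = seen F v m i := fun i hi => by
      have hi' := hi.mono k.le_succ
      rw [ih.1.seen_succ hF hi', ih.2 i hi']
    refine ⟨fun i j hi hj => ?_, key⟩
    rw [key i hi, key j hj]
    exact h i j (hi.mono (by omega)) (hj.mono (by omega))

/-- In a round without a crash, every agent alive at its start reaches everyone, so each survivor
ends with the union of the sets of all those agents. -/
theorem seenUniform_succ_of_no_crash {F : Adversary n} (hF : F ∈ Crash n t) (v : Fin n → Value)
    {k : ℕ} (h : ∀ i, Alive F k i → F k i i = true) : SeenUniform F v (k + 1) := by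
  have key : ∀ i, Alive F (k + 1) i → ∀ w,
      w ∈ seen F v (k + 1) i ↔ ∃ j, Alive F k j ∧ w ∈ seen F v k j := by
    intro i hi w
    rw [mem_seen_succ]
    constructor
    · rintro (hw | ⟨j, hj, hw⟩)
      exacts [⟨i, hi.mono k.le_succ, hw⟩, ⟨j, alive_of_delivered hF hj, hw⟩]
    · rintro ⟨j, hj, hw⟩
      exact .inr ⟨j, delivered_of_alive hF (h j hj) i, hw⟩
  intro i j hi hj
  ext w
  rw [key i hi, key j hj]

-- A crash-free round makes the sets uniform for good. Otherwise each of the first `m` rounds has a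
-- new crash, so `m ≤ t`; the bound then forces `n - 1 ≤ m`, leaving at most one agent alive.
open Classical in
theorem seenUniform_of_le {F : Adversary n} (hF : F ∈ Crash n t) (v : Fin n → Value)
    {m : ℕ} (hm : min (t + 1) (n - 1) ≤ m) : SeenUniform F v m := by
  by_cases hc : ∃ k < m, ∀ i, Alive F k i → F k i i = true
  · obtain ⟨k, hk, h⟩ := hc
    exact ((seenUniform_succ_of_no_crash hF v h).seen_eq hF hk).1
  · push Not at hc
    have hcard : ∀ k ≤ m, k ≤ (Finset.univ.filter fun i => ¬ Alive F k i).card := by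
      intro k hk
      induction k with
      | zero => exact Nat.zero_le _
      | succ k ih =>
        obtain ⟨i, hi, hi'⟩ := hc k hk
        refine Nat.succ_le_of_lt ((ih (by omega)).trans_lt (Finset.card_lt_card ?_))
        refine Finset.ssubset_iff_of_subset (fun j hj => ?_) |>.2 ⟨i, ?_, ?_⟩
        · simp only [Finset.mem_filter, Finset.mem_univ, true_and] at hj ⊢
          exact fun h => hj (h.mono k.le_succ)
        · simp only [Finset.mem_filter, Finset.mem_univ, true_and]
          exact fun h => hi' (alive_succ.1 h).2
        · simpa using hi
    have hdead := hcard m le_rfl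
    have hfaulty : (Finset.univ.filter fun i => ¬ Alive F m i).card ≤ t := by
      refine le_trans ?_ hF.2.2
      rw [← Set.ncard_coe_finset]
      refine Set.ncard_le_ncard (fun i hi => ?_) (Set.toFinite _)
      simp only [Alive, Finset.coe_filter, Finset.mem_univ, true_and, Set.mem_ofPred_eq,
        not_forall] at hi
      obtain ⟨k, -, hk⟩ := hi
      exact ⟨k, i, by simpa using hk⟩
    have hsum := Finset.card_filter_add_card_filter_not (s := (Finset.univ : Finset (Fin n)))
      (fun i => Alive F m i)
    rw [Finset.card_univ, Fintype.card_fin] at hsum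
    have hone : (Finset.univ.filter fun i => Alive F m i).card ≤ 1 := by omega
    intro i j hi hj
    rw [Finset.card_le_one.1 hone i (by simpa using hi) j (by simpa using hj)]

/-! ### Indistinguishability chains before the bound -/

/-- The adversary that lets no agent crash. -/
def failureFree (n : ℕ) : Adversary n := fun _ _ _ => true

theorem failureFree_mem_crash : failureFree n ∈ Crash n t := by
  simp [Crash, failureFree]

theorem alive_failureFree (m : ℕ) (i : Fin n) : Alive (failureFree n) m i := fun _ _ => rfl

theorem mem_seen_failureFree (v : Fin n → Value) {m : ℕ} (hm : 1 ≤ m) (i j : Fin n) :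
    v j ∈ seen (failureFree n) v m i := by
  obtain ⟨m, rfl⟩ := Nat.exists_eq_add_of_le' hm
  exact mem_seen_succ.2 (.inr ⟨j, rfl, init_mem_seen _ v m j⟩)

theorem eq_or_eq_of_ne : ∀ {a b : Value}, a ≠ b → ∀ c : Value, c = a ∨ c = b := by
  decide

theorem one_sub_ne : ∀ x : Value, 1 - x ≠ x := by
  decide

theorem finset_value_eq_univ {s : Finset Value} {a b : Value} (ha : a ∈ s) (hb : b ∈ s)
    (h : a ≠ b) : s = Finset.univ := by
  refine Finset.eq_univ_of_forall fun c => ?_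
  rcases eq_or_eq_of_ne h c with rfl | rfl <;> assumption

theorem seen_failureFree_eq_univ {v : Fin n → Value} {m : ℕ} (hm : 1 ≤ m) {i j k : Fin n}
    (h : v j ≠ v k) : seen (failureFree n) v m i = Finset.univ :=
  finset_value_eq_univ (mem_seen_failureFree v hm i j) (mem_seen_failureFree v hm i k) h

/-- The adversary under which agents `0, …, m - 1` crash one after the other, agent `i` in round
`i + 1`, where it reaches agent `i + 1` only. -/
def chain (n m : ℕ) : Adversary n := fun k i j =>
  decide (m ≤ i.val ∨ k < i.val ∨ (k = i.val ∧ j.val = i.val + 1))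

theorem chain_mem_crash {m : ℕ} (hm : m ≤ t) : chain n m ∈ Crash n t := by
  refine ⟨fun k i j h => ?_, fun k i h k' hk j => ?_, ?_⟩
  · simp only [chain, decide_eq_false_iff_not] at h ⊢
    omega
  · simp only [chain, decide_eq_false_iff_not] at h ⊢
    omega
  · have hsub : (Fin.val '' {i : Fin n | ∃ k j, chain n m k i j = false}) ⊆
        (Finset.range m : Set ℕ) := by
      rintro _ ⟨i, ⟨k, j, h⟩, rfl⟩
      simp only [chain, decide_eq_false_iff_not] at h
      simp only [Finset.coe_range, Set.mem_Iio]
      omega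
    have := Set.ncard_le_ncard hsub (Finset.finite_toSet _)
    rw [Set.ncard_image_of_injective _ Fin.val_injective, Set.ncard_coe_finset,
      Finset.card_range] at this
    exact this.trans hm

theorem alive_chain {m : ℕ} {i : Fin n} (h : m ≤ i.val) (k : ℕ) : Alive (chain n m) k i :=
  fun l _ => by simp [chain, h]

/-- One agent, number `0`, has the value `y`, the others have `x`. -/
def oneOdd (x y : Value) : Fin n → Value := fun i => if i.val = 0 then y else x

/-- The odd value `y` travels along the crashing agents at one agent per round, so at time `k` it
has not got beyond agent `k`. -/
theorem seen_chain_of_lt (x y : Value) {m k : ℕ} (hk : k ≤ m) {j : Fin n} (hj : k < j.val) :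
    seen (chain n m) (oneOdd x y) k j = {x} := by
  refine Finset.eq_singleton_iff_unique_mem.2 ⟨?_, ?_⟩
  · have := init_mem_seen (chain n m) (oneOdd x y) k j
    rwa [oneOdd, if_neg (by omega)] at this
  · induction k generalizing j with
    | zero =>
      intro w hw
      simpa [seen, oneOdd, show j.val ≠ 0 by omega] using hw
    | succ k ih =>
      intro w hw
      rcases mem_seen_succ.1 hw with hw | ⟨i, hi, hw⟩
      · exact ih (by omega) (by omega) w hw
      · simp only [chain, decide_eq_true_eq] at hi
        exact ih (by omega) (by omega) w hw

theorem mem_seen_chain (x y : Value) {m k : ℕ} (hn : k < n) :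
    y ∈ seen (chain n m) (oneOdd x y) k ⟨k, hn⟩ := by
  induction k with
  | zero => simp [seen, oneOdd]
  | succ k ih =>
    exact mem_seen_succ.2 (.inr ⟨⟨k, by omega⟩, by simp [chain], ih (by omega)⟩)

/-- A property of runs that is respected by what nonfailed agents cannot distinguish at time `m`,
where `m < min (t + 1) (n - 1)`, spreads from any run with a nonfailed agent to all failure-free
runs with constant initial values. -/
theorem failureFree_const_of_closed {m : ℕ} (hm : m < min (t + 1) (n - 1))
    (A : Adversary n → (Fin n → Value) → Prop)
    (hA : ∀ F ∈ Crash n t, ∀ F' ∈ Crash n t, ∀ v v' i, Alive F m i → Alive F' m i →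
      seen F v m i = seen F' v' m i → v i = v' i → A F v → A F' v')
    {F : Adversary n} (hF : F ∈ Crash n t) {v : Fin n → Value} {i : Fin n} (hi : Alive F m i)
    (h : A F v) (w : Value) : A (failureFree n) fun _ => w := by
  -- The two terms of the minimum: `m` crashes are allowed, and there is an agent numbered above
  -- `m`.
  have hmt : m ≤ t := by omega
  have hmn : m + 1 < n := by omega
  have hfree : ∀ u u' : Fin n → Value, ∀ i, seen (failureFree n) u m i =
      seen (failureFree n) u' m i → u i = u' i → A (failureFree n) u → A (failureFree n) u' :=
    fun u u' i => hA _ failureFree_mem_crash _ failureFree_mem_crash u u' i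
      (alive_failureFree m i) (alive_failureFree m i)
  obtain ⟨u, hu⟩ : ∃ u, A (failureFree n) u := by
    -- Failures are removed first. If `i` has seen only its own value, a constant run looks the same
    -- to it; if it has seen both, the failure-free run with the same initial values does.
    by_cases hs : seen F v m i = {v i}
    · exact ⟨fun _ => v i, hA F hF _ failureFree_mem_crash v _ i hi (alive_failureFree m i)
        (by rw [hs, seen_const]) rfl h⟩
    · obtain ⟨x, hx, hne⟩ : ∃ x ∈ seen F v m i, x ≠ v i := by
        by_contra hc
        push Not at hc
        exact hs (Finset.eq_singleton_iff_unique_mem.2 ⟨init_mem_seen F v m i, hc⟩)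
      have h1 : 1 ≤ m := by
        by_contra hc
        obtain rfl : m = 0 := by omega
        exact hs rfl
      obtain ⟨j, hj⟩ := exists_init_of_mem_seen hx
      refine ⟨v, hA F hF _ failureFree_mem_crash v v i hi (alive_failureFree m i) ?_ rfl h⟩
      rw [finset_value_eq_univ hx (init_mem_seen F v m i) hne,
        seen_failureFree_eq_univ h1 (j := j) (k := i) (by rwa [hj])]
  let a0 : Fin n := ⟨0, by omega⟩
  let a1 : Fin n := ⟨1, by omega⟩
  rcases Nat.eq_zero_or_pos m with rfl | h1
  · have h01 : a0 ≠ a1 := by simp [a0, a1]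
    -- At time 0 an agent knows only its own value: `a0` cannot tell `u` from `c`, and `a1` cannot
    -- tell `c` from the constant `w`.
    let c : Fin n → Value := Function.update (fun _ => w) a0 (u a0)
    have hc0 : c a0 = u a0 := by simp [c]
    have hc1 : c a1 = w := by simp [c, h01.symm]
    have hc : A (failureFree n) c := hfree u c a0 (by simp [seen, hc0]) hc0.symm hu
    exact hfree c _ a1 (by simp [seen, hc1]) hc1 hc
  have h2 : 2 < n := by omega
  let a2 : Fin n := ⟨2, h2⟩
  have hmixed : ∀ a b : Fin n → Value, (∃ j k, a j ≠ a k) → (∃ j k, b j ≠ b k) →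
      A (failureFree n) a → A (failureFree n) b := by
    rintro a b ⟨j, k, hjk⟩ ⟨j', k', hjk'⟩ ha
    -- `c` copies `a` at `a0` and `b` at `a1`. Agent `a2` keeps `c` nonconstant, so that everyone
    -- sees both values in all three runs; this is why three agents are needed.
    let c : Fin n → Value := fun l =>
      if l = a0 then a a0 else if l = a1 then b a1 else 1 - a a0
    have hc0 : c a0 = a a0 := by simp [c]
    have hc1 : c a1 = b a1 := by simp [c, a0, a1]
    have hc2 : c a2 = 1 - a a0 := by simp [c, a0, a1, a2]
    have hc : c a0 ≠ c a2 := by rw [hc0, hc2]; exact (one_sub_ne _).symm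
    have hAc : A (failureFree n) c := hfree a c a0
      (by rw [seen_failureFree_eq_univ h1 hjk, seen_failureFree_eq_univ h1 hc]) hc0.symm ha
    exact hfree c b a1
      (by rw [seen_failureFree_eq_univ h1 hjk', seen_failureFree_eq_univ h1 hc]) hc1 hAc
  -- The run with adversary `chain n m` joins two failure-free runs. `mid`, where the chain ends,
  -- has seen both values, as in the failure-free run with one odd agent; `last` has seen only `x`,
  -- as in the constant run.
  let last : Fin n := ⟨n - 1, by omega⟩
  let mid : Fin n := ⟨m, by omega⟩
  have hodd_last : ∀ x y : Value, oneOdd x y last = x := fun x y => if_neg (by simp [last]; omega)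
  have hodd_mid : ∀ x y : Value, oneOdd x y mid = x := fun x y => if_neg (by simp [mid]; omega)
  have hodd_zero : ∀ x y : Value, oneOdd x y a0 = y := fun x y => if_pos rfl
  have hne : ∀ x y : Value, x ≠ y → oneOdd x y last ≠ oneOdd x y a0 := fun x y hxy => by
    rwa [hodd_last, hodd_zero]
  have hlast : ∀ x y : Value, seen (chain n m) (oneOdd x y) m last =
      seen (failureFree n) (fun _ => x) m last := fun x y => by
    rw [seen_const, seen_chain_of_lt x y le_rfl (by simp [last]; omega)]
  have hmid : ∀ x y : Value, x ≠ y → seen (chain n m) (oneOdd x y) m mid =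
      seen (failureFree n) (oneOdd x y) m mid := fun x y hxy => by
    rw [seen_failureFree_eq_univ h1 (hne x y hxy)]
    refine finset_value_eq_univ ?_ (mem_seen_chain x y (by omega)) hxy
    have := init_mem_seen (chain n m) (oneOdd x y) m mid
    rwa [hodd_mid] at this
  have alive_last : Alive (chain n m) m last := alive_chain (by simp [last]; omega) m
  have alive_mid : Alive (chain n m) m mid := alive_chain (i := mid) (le_refl m) m
  have hto : ∀ x y : Value, x ≠ y → A (failureFree n) (oneOdd x y) →
      A (failureFree n) fun _ => x := fun x y hxy ha =>
    hA _ (chain_mem_crash hmt) _ failureFree_mem_crash (oneOdd x y) _ last alive_last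
      (alive_failureFree m last) (hlast x y) (hodd_last x y)
      (hA _ failureFree_mem_crash _ (chain_mem_crash hmt) _ _ mid (alive_failureFree m mid)
        alive_mid (hmid x y hxy).symm rfl ha)
  have hfrom : ∀ x y : Value, x ≠ y → (A (failureFree n) fun _ => x) →
      A (failureFree n) (oneOdd x y) := fun x y hxy ha =>
    hA _ (chain_mem_crash hmt) _ failureFree_mem_crash _ _ mid alive_mid
      (alive_failureFree m mid) (hmid x y hxy) rfl
      (hA _ failureFree_mem_crash _ (chain_mem_crash hmt) (fun _ => x) (oneOdd x y) last
        (alive_failureFree m last) alive_last (hlast x y).symm (hodd_last x y).symm ha)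
  have hw : w ≠ 1 - w := (one_sub_ne w).symm
  by_cases hu' : ∃ j k, u j ≠ u k
  · exact hto w (1 - w) hw (hmixed u _ hu' ⟨_, _, hne _ _ hw⟩ hu)
  · push Not at hu'
    have hux : u = fun _ => u a0 := funext fun j => hu' j a0
    rw [hux] at hu
    by_cases hx : u a0 = w
    · rwa [hx] at hu
    · exact hto w (1 - w) hw (hmixed _ _ ⟨_, _, hne _ _ hx⟩ ⟨_, _, hne _ _ hw⟩
        (hfrom _ _ hx hu))

/-! ### Common knowledge of initial values -/

theorem floodLoc_eq_iff {F F' : Adversary n} (hF : F ∈ Crash n t) (hF' : F' ∈ Crash n t)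
    {v v' : Fin n → Value} {m m' : ℕ} {i : Fin n} (hi : Alive F m i) :
    floodLoc F v m i = floodLoc F' v' m' i ↔
      Alive F' m' i ∧ seen F v m i = seen F' v' m' i ∧ m = m' ∧ v i = v' i := by
  rw [floodLoc_of_alive hF v hi]
  by_cases hi' : Alive F' m' i
  · rw [floodLoc_of_alive hF' v' hi']
    exact (FloodState.live.injEq ..).to_iff.trans (by simp [hi'])
  · rw [(floodLoc_of_alive_of_not hF' v' m' i).2 hi']
    exact ⟨fun h => (nomatch h), fun h => absurd h.1 hi'⟩

theorem floodRun_mem_runs {F : Adversary n} (hF : F ∈ Crash n t) (v : Fin n → Value)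
    (P : DecisionProtocol (flood n)) : floodRun F v ∈ Runs (flood n) P t :=
  mem_runs_flood_iff.2 ⟨F, hF, v, rfl⟩

theorem not_common_existsVal (P : DecisionProtocol (flood n)) {F : Adversary n}
    (hF : F ∈ Crash n t) {v : Fin n → Value} {m : ℕ} (hm : m < min (t + 1) (n - 1)) {i : Fin n}
    (hi : Alive F m i) (x : Value) :
    ¬ Sat (system (flood n) P t) (Formula.common (Formula.atom (Atom.existsVal x)))
      (floodRun F v) m := by
  intro h
  have hfin := failureFree_const_of_closed hm (fun F v => Sat (system (flood n) P t)
    (Formula.common (Formula.atom (Atom.existsVal x))) (floodRun F v) m)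
    (fun F hF F' hF' v v' j hj hj' hs hv h k hk => by
      -- Level `k + 1` at the first point says that `j` knows level `k`, which therefore holds at
      -- the second point.
      have h' := h (k + 1) (by omega)
      rw [Function.iterate_succ_apply'] at h'
      exact h' j ((mem_nonfailed_floodRun hF).2 hj) _ (floodRun_mem_runs hF' v' P) m
        ((floodLoc_eq_iff hF hF' hj).2 ⟨hj', hs, rfl, hv⟩)) hF hi h (1 - x)
  obtain ⟨j, hj⟩ := hfin 1 le_rfl i
    ((mem_nonfailed_floodRun failureFree_mem_crash (t := t)).2 (alive_failureFree m i)) _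
    (floodRun_mem_runs failureFree_mem_crash _ P) m rfl
  exact one_sub_ne x ((hasInit_floodRun (v := fun _ : Fin n => 1 - x)).1 hj)

/-- "All nonfailed agents have seen `x`" is a fixed point: a local state fixes the time and the seen
set, and by uniformity at any indistinguishable point the other nonfailed agents have that set too.
-/
theorem common_existsVal (P : DecisionProtocol (flood n)) {m : ℕ}
    (hm : min (t + 1) (n - 1) ≤ m) {x : Value} {F : Adversary n} (hF : F ∈ Crash n t)
    {v : Fin n → Value} (hx : ∀ i, Alive F m i → x ∈ seen F v m i) :
    Sat (system (flood n) P t) (Formula.common (Formula.atom (Atom.existsVal x)))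
      (floodRun F v) m := by
  intro k hk
  induction k, hk using Nat.le_induction generalizing F v with
  | base =>
    rintro i hi _ hr m' hloc
    obtain ⟨F', hF', v', rfl⟩ := mem_runs_flood_iff.1 hr
    have hi := (mem_nonfailed_floodRun hF).1 hi
    obtain ⟨hi', hs, -, -⟩ := (floodLoc_eq_iff hF hF' hi).1 hloc
    obtain ⟨j, hj⟩ := exists_init_of_mem_seen (hs ▸ hx i hi)
    exact ⟨j, hasInit_floodRun.2 hj⟩
  | succ k _ ih =>
    rw [Function.iterate_succ_apply']
    rintro i hi _ hr m' hloc
    obtain ⟨F', hF', v', rfl⟩ := mem_runs_flood_iff.1 hr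
    have hi := (mem_nonfailed_floodRun hF).1 hi
    obtain ⟨hi', hs, rfl, -⟩ := (floodLoc_eq_iff hF hF' hi).1 hloc
    refine ih hF' fun j hj => ?_
    rw [seenUniform_of_le hF' v' hm j i hj hi', ← hs]
    exact hx i hi

theorem sat_knowsCommonValue_iff (P : DecisionProtocol (flood n)) {r : Run (flood n)}
    (hr : r ∈ Runs (flood n) P t) {m : ℕ} {i : Fin n} (hi : i ∈ Nonfailed r m) :
    Sat (system (flood n) P t) (knowsCommonValue i) r m ↔ min (t + 1) (n - 1) ≤ m := by
  obtain ⟨F, hF, v, rfl⟩ := mem_runs_flood_iff.1 hr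
  rw [mem_nonfailed_floodRun hF] at hi
  constructor
  · intro h
    by_contra hm
    rw [not_le] at hm
    rcases h with h | h
    · exact not_common_existsVal P hF hm hi 0 (h _ hr m rfl)
    · exact not_common_existsVal P hF hm hi 1 (h _ hr m rfl)
  · intro hm
    -- The witness is the agent's own initial value, which it has certainly seen.
    have key : Sat (system (flood n) P t)
        (Formula.know i (Formula.common (Formula.atom (Atom.existsVal (v i)))))
        (floodRun F v) m := by
      rintro _ hr' m' hloc
      obtain ⟨F', hF', v', rfl⟩ := mem_runs_flood_iff.1 hr'
      obtain ⟨hi', hs, rfl, -⟩ := (floodLoc_eq_iff hF hF' hi).1 hloc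
      refine common_existsVal P hm hF' fun j hj => ?_
      rw [seenUniform_of_le hF' v' hm j i hj hi', ← hs]
      exact init_mem_seen F v m i
    have h01 : v i = 0 ∨ v i = 1 := eq_or_eq_of_ne (by decide) _
    rcases h01 with h | h <;> rw [h] at key
    exacts [.inl key, .inr key]

/-- Rules out the vacuous case of the second equivalence, in which no agent is left to know
anything. -/
theorem exists_alive {F : Adversary n} (hF : F ∈ Crash n t) (h : t < n) (m : ℕ) :
    ∃ i, Alive F m i := by
  by_contra hc
  push Not at hc
  have huniv : {i : Fin n | ∃ m j, F m i j = false} = Set.univ := by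
    refine Set.eq_univ_of_forall fun i => ?_
    have := hc i
    simp only [Alive, not_forall] at this
    obtain ⟨k, -, hk⟩ := this
    exact ⟨k, i, by simpa using hk⟩
  have := hF.2.2
  rw [huniv, Set.ncard_univ, Nat.card_eq_fintype_card, Fintype.card_fin] at this
  omega

/-! ### Correctness and optimality of `floodPlus` -/

theorem decides_floodPlus_iff {F : Adversary n} (hF : F ∈ Crash n t) {v : Fin n → Value}
    {m : ℕ} {i : Fin n} {x : Value} :
    Decides (floodPlus n t) (floodRun F v) m i x ↔ Alive F m i ∧ min (t + 1) (n - 1) ≤ m ∧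
      (seen F v m i).min' ⟨v i, init_mem_seen F v m i⟩ = x := by
  rw [Decides, mem_nonfailed_floodRun hF]
  refine and_congr_right fun hi => ?_
  change floodPlus n t i (floodLoc F v m i) = _ ↔ _
  rw [floodLoc_of_alive hF v hi]
  have hne : (seen F v m i).Nonempty := ⟨v i, init_mem_seen F v m i⟩
  by_cases hm : min (t + 1) (n - 1) ≤ m
  · simp only [floodPlus, dif_pos hne, hm, if_true, true_and]
    exact (Action.decideVal.injEq ..).to_iff
  · simp only [floodPlus, hm, if_false, false_and, reduceCtorEq]

theorem isSBA_floodPlus : IsSBA (flood n) t (floodPlus n t) := by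
  refine ⟨?_, ?_, ?_⟩
  · intro r hr
    obtain ⟨F, hF, v, rfl⟩ := mem_runs_flood_iff.1 hr
    intro m m' i j x x' h h'
    obtain ⟨hi, hm, rfl⟩ := (decides_floodPlus_iff hF).1 h
    obtain ⟨hj, hm', rfl⟩ := (decides_floodPlus_iff hF).1 h'
    -- Uniformity is taken at the bound itself, so that decisions at two different later times
    -- compare with the same frozen set.
    have hT := seenUniform_of_le hF v (le_refl (min (t + 1) (n - 1)))
    have e : seen F v m i = seen F v m' j := by
      rw [(hT.seen_eq hF hm).2 i hi, (hT.seen_eq hF hm').2 j hj]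
      exact hT i j (hi.mono hm) (hj.mono hm')
    simp only [e]
  · intro r hr
    obtain ⟨F, hF, v, rfl⟩ := mem_runs_flood_iff.1 hr
    intro m i x h
    obtain ⟨-, -, rfl⟩ := (decides_floodPlus_iff hF).1 h
    obtain ⟨j, hj⟩ := exists_init_of_mem_seen (Finset.min'_mem (seen F v m i) _)
    exact ⟨j, hasInit_floodRun.2 hj⟩
  · intro r hr
    obtain ⟨F, hF, v, rfl⟩ := mem_runs_flood_iff.1 hr
    intro m i x h j hj
    exact ⟨_, (decides_floodPlus_iff hF).2 ⟨(mem_nonfailed_floodRun hF).1 hj,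
      ((decides_floodPlus_iff hF).1 h).2.1, rfl⟩⟩

/-- By simultaneity and agreement, one decision on `x` means that all nonfailed agents decide `x`.
Decisions depend only on local states, so this spreads along indistinguishable points to the run
with all values `1 - x`, against validity. -/
theorem IsSBA.le_of_decides {P : DecisionProtocol (flood n)} (hP : IsSBA (flood n) t P)
    {F : Adversary n} (hF : F ∈ Crash n t) {v : Fin n → Value} {m : ℕ} {i : Fin n} {x : Value}
    (h : Decides P (floodRun F v) m i x) : min (t + 1) (n - 1) ≤ m := by
  by_contra hm
  rw [not_le] at hm
  have hall : ∀ F ∈ Crash n t, ∀ v j, Decides P (floodRun F v) m j x →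
      ∀ k, Alive F m k → Decides P (floodRun F v) m k x := by
    intro F hF v j hj k hk
    have hr := floodRun_mem_runs hF v P
    obtain ⟨w, hw⟩ := hP.simultaneity _ hr m j x hj k ((mem_nonfailed_floodRun hF).2 hk)
    rwa [hP.agreement _ hr m m j k x w hj hw]
  have hi := (mem_nonfailed_floodRun hF).1 h.1
  have hfin := failureFree_const_of_closed hm
    (fun F v => ∀ k, Alive F m k → Decides P (floodRun F v) m k x)
    (fun F hF F' hF' v v' j hj hj' hs hv hd => by
      refine hall F' hF' v' j ⟨(mem_nonfailed_floodRun hF').2 hj', ?_⟩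
      have hloc : (floodRun F v m).loc j = (floodRun F' v' m).loc j :=
        (floodLoc_eq_iff hF hF' hj).2 ⟨hj', hs, rfl, hv⟩
      rw [← hloc]
      exact (hd j hj).2) hF hi (hall F hF v i h) (1 - x) i (alive_failureFree m i)
  obtain ⟨j, hj⟩ := hP.validity _ (floodRun_mem_runs failureFree_mem_crash _ P) m i x hfin
  exact one_sub_ne x ((hasInit_floodRun (v := fun _ : Fin n => 1 - x)).1 hj)

theorem isOptimumSBA_floodPlus : IsOptimumSBA (flood n) t (floodPlus n t) := by
  refine ⟨isSBA_floodPlus, fun P hP r hr r' hr' hrr m i x h => ?_⟩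
  obtain ⟨F, hF, v, rfl⟩ := mem_runs_flood_iff.1 hr
  obtain ⟨F', hF', v', rfl⟩ := mem_runs_flood_iff.1 hr'
  obtain rfl : F = F' := hrr.2
  exact ⟨_, (decides_floodPlus_iff hF).2
    ⟨(mem_nonfailed_floodRun hF).1 h.1, hP.le_of_decides hF h, rfl⟩⟩

theorem terminates_floodPlus : Terminates (flood n) t (floodPlus n t) := by
  intro r hr i
  obtain ⟨F, hF, v, rfl⟩ := mem_runs_flood_iff.1 hr
  refine ⟨min (t + 1) (n - 1), or_iff_not_imp_left.2 fun hi => ?_⟩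
  exact ⟨_, (decides_floodPlus_iff hF).2
    ⟨(mem_nonfailed_floodRun hF).1 (not_not.1 hi), le_rfl, rfl⟩⟩

end SBA

theorem mainTheorem4 (n t : ℕ) (ht : t ≤ n) :
    (∀ P : SBA.DecisionProtocol (SBA.flood n),
      ∀ r ∈ (SBA.system (SBA.flood n) P t).runs, ∀ m : ℕ,
        (∀ i ∈ SBA.Nonfailed r m,
          (SBA.Sat (SBA.system (SBA.flood n) P t) (SBA.knowsCommonValue i) r m ↔
            min (t + 1) (n - 1) ≤ m)) ∧
        (t < n →
          ((∀ i ∈ SBA.Nonfailed r m,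
            SBA.Sat (SBA.system (SBA.flood n) P t) (SBA.knowsCommonValue i) r m) ↔
              min (t + 1) (n - 1) ≤ m))) ∧
    SBA.IsOptimumSBA (SBA.flood n) t (SBA.floodPlus n t) ∧
    SBA.Terminates (SBA.flood n) t (SBA.floodPlus n t) := by
  refine ⟨fun P r hr m => ⟨fun i hi => SBA.sat_knowsCommonValue_iff P hr hi, fun htn => ?_⟩,
    SBA.isOptimumSBA_floodPlus, SBA.terminates_floodPlus⟩
  refine ⟨fun h => ?_, fun hm i hi => (SBA.sat_knowsCommonValue_iff P hr hi).2 hm⟩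
  obtain ⟨F, hF, v, rfl⟩ := SBA.mem_runs_flood_iff.1 hr
  obtain ⟨i, hi⟩ := SBA.exists_alive hF htn m
  have hi := (SBA.mem_nonfailed_floodRun hF (v := v)).2 hi
  exact (SBA.sat_knowsCommonValue_iff P hr hi).1 (h i hi)
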